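/- For $\alpha\in\mathbb R$ let $\mathbb{A}_\alpha^{\mathbb Z}$ be the universal unital $C^*$-algebra generated by unitaries $u_l$, $l\in\mathbb Z$, subject to the relations $u_lu_k=e^{i\alpha}u_ku_l$ for all $l<k$. For every strictly increasing map $h:\mathbb Z\to\mathbb Z$ let $\alpha_h$ be the unital $*$-endomorphism of $\mathbb{A}_\alpha^{\mathbb Z}$ with $\alpha_h(u_l)=u_{h(l)}$ for all $l\in\mathbb Z$, and for every $z\in\mathbb T=\{z\in\mathbb C:|z|=1\}$ let $\gamma_z$ be the gauge automorphism, that is, the $*$-automorphism of $\mathbb{A}_\alpha^{\mathbb Z}$ with $\gamma_z(u_l)=zu_l$ for all $l\in\mathbb Z$. A state $\varphi$ on $\mathbb{A}_\alpha^{\mathbb Z}$ is called spreadable if $\varphi\circ\alpha_h=\varphi$ for every strictly increasing $h:\mathbb Z\to\mathbb Z$. Put $$\Delta_\alpha=\{k\in\mathbb Z: e^{i\alpha k^2}=1\},\qquad \Delta_\alpha^\perp=\{z\in\mathbb T: z^l=1\ \text{for all } l\in\Delta_\alpha\}.$$ Then every spreadable state $\varphi$ on $\mathbb{A}_\alpha^{\mathbb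 Z}$ is $\Delta_\alpha^\perp$-invariant, that is, $\varphi\circ\gamma_z=\varphi$ for all $z\in\Delta_\alpha^\perp$. In particular, if $\frac{\alpha}{2\pi}$ is irrational, then every spreadable state $\varphi$ on $\mathbb{A}_\alpha^{\mathbb Z}$ is gauge invariant, that is, $\varphi\circ\gamma_z=\varphi$ for all $z\in\mathbb T$. -/

import Mathlib

open scoped ComplexOrder ENNReal

noncomputable section

universe v

/-- A family `w : ℤ → B` in a unital C*-algebra consisting of unitaries which satisfy
`w l * w k = exp(iα) • (w k * w l)` for all `l < k`. -/
def IsTorusFamily (α : ℝ) {B : Type*} [CStarAlgebra B] (w : ℤ → B) : Prop :=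
  (∀ l, w l ∈ unitary B) ∧
    ∀ l k, l < k → w l * w k = Complex.exp (α * Complex.I) • (w k * w l)

/-- A representation of the defining relations in a (nonzero, unital) C*-algebra. -/
structure TorusRep (α : ℝ) : Type 1 where
  alg : Type
  [cstar : CStarAlgebra alg]
  [nontriv : Nontrivial alg]
  gen : ℤ → alg
  isTorusFamily : IsTorusFamily α gen

namespace TorusRep

instance (α : ℝ) (j : TorusRep α) : CStarAlgebra j.alg := j.cstar
instance (α : ℝ) (j : TorusRep α) : Nontrivial j.alg := j.nontriv

/-- The C*-algebra of all bounded families `(T_j)_j`, `T_j ∈ j.alg`, with the supremum norm;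
`j` runs over all representations of the relations. -/
abbrev Product (α : ℝ) : Type 1 := lp (fun j : TorusRep α => j.alg) ∞

instance (α : ℝ) : CStarAlgebra (Product α) where

/-- The bounded family `(j.gen l)_j`. -/
def productGen (α : ℝ) (l : ℤ) : Product α :=
  ⟨fun j => j.gen l, memℓp_infty ⟨1, by
    rintro _ ⟨j, rfl⟩
    exact (CStarRing.norm_of_mem_unitary (j.isTorusFamily.1 l)).le⟩⟩

/-- The coordinate *-homomorphism. -/
def productEval {α : ℝ} (j : TorusRep α) : Product α →⋆ₐ[ℂ] j.alg where
  toFun T := T j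
  map_one' := rfl
  map_mul' _ _ := rfl
  map_zero' := rfl
  map_add' _ _ := rfl
  commutes' _ := rfl
  map_star' _ := rfl

end TorusRep

/-- The infinite noncommutative torus `𝔸_α^ℤ`: the universal unital C*-algebra generated by
unitaries `u_l`, `l ∈ ℤ`, with `u_l u_k = exp(iα) u_k u_l` for `l < k`. It is the C*-algebra
generated by the `u_l = (j.gen l)_j` in the product of all representations of the relations, so
that its norm is the supremum over all representations.
See `NCTorus.isTorusFamily_gen`, `NCTorus.dense_adjoin_gen` and `NCTorus.exists_hom` (which
allows target C*-algebras in every universe). -/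
abbrev NCTorus (α : ℝ) : Type 1 :=
  (StarAlgebra.adjoin ℂ (Set.range (TorusRep.productGen α))).topologicalClosure

namespace NCTorus

instance (α : ℝ) : CStarAlgebra (NCTorus α) :=
  StarSubalgebra.cstarAlgebra
    (StarAlgebra.adjoin ℂ (Set.range (TorusRep.productGen α))).topologicalClosure
    (h_closed := StarSubalgebra.isClosed_topologicalClosure _)

/-- The usual order of a C*-algebra: `a ≤ b` iff `b - a` is a positive element. -/
instance (α : ℝ) : PartialOrder (NCTorus α) := CStarAlgebra.spectralOrder _

instance (α : ℝ) : StarOrderedRing (NCTorus α) := CStarAlgebra.spectralOrderedRing _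

/-- The inclusion in the product of all representations. -/
def incl (α : ℝ) : NCTorus α →⋆ₐ[ℂ] TorusRep.Product α :=
  StarSubalgebra.subtype
    (StarAlgebra.adjoin ℂ (Set.range (TorusRep.productGen α))).topologicalClosure

theorem incl_injective (α : ℝ) : Function.Injective (incl α) := Subtype.val_injective

theorem isometry_incl (α : ℝ) : Isometry (incl α) := isometry_subtype_coe

/-- The unitary generator `u_l`. -/
def gen (α : ℝ) (l : ℤ) : NCTorus α :=
  ⟨TorusRep.productGen α l, StarSubalgebra.le_topologicalClosure _
    (StarAlgebra.subset_adjoin ℂ _ ⟨l, rfl⟩)⟩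

theorem incl_gen (α : ℝ) (l : ℤ) : incl α (gen α l) = TorusRep.productGen α l := rfl

theorem isTorusFamily_gen (α : ℝ) : IsTorusFamily α (gen α) := by
  refine ⟨fun l => ?_, fun l k h => ?_⟩
  · rw [Unitary.mem_iff]
    constructor <;> apply incl_injective <;>
      rw [map_mul, map_star, map_one, incl_gen] <;> ext j
    · exact ((Unitary.mem_iff).1 (j.isTorusFamily.1 l)).1
    · exact ((Unitary.mem_iff).1 (j.isTorusFamily.1 l)).2
  · apply incl_injective
    rw [map_smul, map_mul, map_mul, incl_gen, incl_gen]
    ext j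
    exact j.isTorusFamily.2 l k h

theorem dense_adjoin_gen (α : ℝ) :
    Dense (StarAlgebra.adjoin ℂ (Set.range (gen α)) : Set (NCTorus α)) := by
  intro a
  rw [(isometry_incl α).isEmbedding.isInducing.closure_eq_preimage_closure_image]
  have h : (incl α '' (StarAlgebra.adjoin ℂ (Set.range (gen α)) : Set (NCTorus α)))
      = (StarAlgebra.adjoin ℂ (Set.range (TorusRep.productGen α)) : Set _) := by
    rw [← StarSubalgebra.coe_map, StarAlgHom.map_adjoin, ← Set.range_comp]
    rfl
  rw [h]
  exact a.2

end NCTorus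

/-- Transport of a C*-algebra structure along a bijection. -/
abbrev CStarAlgebra.transfer {A : Type*} {B : Type*} [CStarAlgebra B] (e : A ≃ B) :
    CStarAlgebra A :=
  letI : NormedRing A := e.normedRing
  letI : StarRing A := e.starRing
  letI : Algebra ℂ A := e.algebra ℂ
  haveI hi : Isometry e := Isometry.of_dist_eq fun _ _ => rfl
  haveI hstar : ∀ a : A, e (star a) = star (e a) := fun a => e.apply_symm_apply _
  haveI hmul : ∀ a b : A, e (a * b) = e a * e b := fun a b => e.apply_symm_apply _
  haveI hsmul : ∀ (c : ℂ) (a : A), e (c • a) = c • e a := fun c a => e.apply_symm_apply _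
  { complete := by
      have : CompleteSpace A := (completeSpace_congr (e := e) hi.isUniformEmbedding).2 inferInstance
      exact fun {f} => this.complete
    norm_mul_self_le := fun a => by
      change ‖e a‖ * ‖e a‖ ≤ ‖e (star a * a)‖
      rw [hmul, hstar]
      exact CStarRing.norm_mul_self_le _
    norm_smul_le := fun c a => by
      change ‖e (c • a)‖ ≤ ‖c‖ * ‖e a‖
      rw [hsmul]
      exact norm_smul_le _ _
    star_smul := fun c a => e.injective <| by
      rw [hstar, hsmul, hsmul, hstar, star_smul] }

/-- The C*-algebra generated by a countable family has at most continuum many elements. -/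
theorem small_closure_adjoin {B : Type v} [CStarAlgebra B] (w : ℤ → B) :
    Small.{0} (StarAlgebra.adjoin ℂ (Set.range w)).topologicalClosure := by
  set S := StarAlgebra.adjoin ℂ (Set.range w)
  have hs : TopologicalSpace.IsSeparable (S : Set B) := by
    have h1 : (S : Set B) =
        Submodule.span ℂ (Submonoid.closure (Set.range w ∪ star (Set.range w)) : Set B) := by
      rw [← Algebra.adjoin_eq_span, ← StarAlgebra.adjoin_toSubalgebra]
      rfl
    rw [h1]
    apply TopologicalSpace.IsSeparable.span
    apply Set.Countable.isSeparable
    have hc : (Set.range w ∪ star (Set.range w)).Countable := by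
      refine (Set.countable_range w).union ?_
      rw [← Set.image_star]
      exact (Set.countable_range w).image _
    have : Countable (Submonoid.closure (Set.range w ∪ star (Set.range w))) := by
      have : Countable (Set.range w ∪ star (Set.range w) : Set B) := hc
      rw [Submonoid.closure_eq_mrange]
      have : Countable (FreeMonoid (Set.range w ∪ star (Set.range w) : Set B)) :=
        inferInstanceAs (Countable (List _))
      exact Set.countable_range (FreeMonoid.lift (Subtype.val : _ → B))
    exact Set.to_countable _
  obtain ⟨D, hD, hD'⟩ := hs.closure
  have : Countable D := hD
  rcases isEmpty_or_nonempty D with h | h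
  · have h0 : (0 : B) ∈ closure (S : Set B) := subset_closure (zero_mem S)
    obtain ⟨x, hx, _⟩ := mem_closure_iff_seq_limit.1 (hD' h0)
    exact h.elim ⟨x 0, hx 0⟩
  let f : (ℕ → D) → B := fun x => Filter.limUnder Filter.atTop fun n => (x n : B)
  have hf : (S.topologicalClosure : Set B) ⊆ Set.range f := by
    intro b hb
    rw [StarSubalgebra.topologicalClosure_coe] at hb
    obtain ⟨x, hx, hl⟩ := mem_closure_iff_seq_limit.1 (hD' hb)
    exact ⟨fun n => ⟨x n, hx n⟩, hl.limUnder_eq⟩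
  exact small_subset hf

namespace NCTorus

/-- Universality of `𝔸_α^ℤ`: every family of unitaries in a unital C*-algebra (in any universe)
which satisfies the relations is the image of the generators under a unital *-homomorphism. -/
theorem exists_hom {α : ℝ} {B : Type v} [CStarAlgebra B] {w : ℤ → B} (hw : IsTorusFamily α w) :
    ∃ f : NCTorus α →⋆ₐ[ℂ] B, ∀ l, f (gen α l) = w l := by
  let S := (StarAlgebra.adjoin ℂ (Set.range w)).topologicalClosure
  have hS : IsClosed (S : Set B) := StarSubalgebra.isClosed_topologicalClosure _
  have hmem : ∀ l, w l ∈ S := fun l =>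
    StarSubalgebra.le_topologicalClosure _ (StarAlgebra.subset_adjoin ℂ _ ⟨l, rfl⟩)
  rcases subsingleton_or_nontrivial B with hB | hB
  · exact ⟨{ toFun := fun _ => 0
             map_one' := Subsingleton.elim _ _
             map_mul' := fun _ _ => Subsingleton.elim _ _
             map_zero' := rfl
             map_add' := fun _ _ => Subsingleton.elim _ _
             commutes' := fun _ => Subsingleton.elim _ _
             map_star' := fun _ => Subsingleton.elim _ _ }, fun _ => Subsingleton.elim _ _⟩
  have hsm : Small.{0} S := small_closure_adjoin w
  let _ : CStarAlgebra S := StarSubalgebra.cstarAlgebra S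
  let e : Shrink.{0} S ≃ S := (equivShrink S).symm
  let _ : CStarAlgebra (Shrink.{0} S) := CStarAlgebra.transfer e
  have : Nontrivial (Shrink.{0} S) := e.nontrivial
  let g : Shrink.{0} S →⋆ₐ[ℂ] B :=
    { toFun := fun x => (e x : B)
      map_one' := congrArg Subtype.val (e.apply_symm_apply 1)
      map_mul' := fun x y => congrArg Subtype.val (e.apply_symm_apply (e x * e y))
      map_zero' := congrArg Subtype.val (e.apply_symm_apply 0)
      map_add' := fun x y => congrArg Subtype.val (e.apply_symm_apply (e x + e y))
      commutes' := fun c => congrArg Subtype.val (e.apply_symm_apply (algebraMap ℂ S c))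
      map_star' := fun x => congrArg Subtype.val (e.apply_symm_apply (star (e x))) }
  have hg : Function.Injective g := fun x y h => e.injective (Subtype.ext h)
  have hgw : ∀ l, g (e.symm ⟨w l, hmem l⟩) = w l := fun l =>
    congrArg Subtype.val (e.apply_symm_apply _)
  let j : TorusRep α :=
    { alg := Shrink.{0} S
      gen := fun l => e.symm ⟨w l, hmem l⟩
      isTorusFamily := by
        refine ⟨fun l => ?_, fun l k h => ?_⟩
        · rw [Unitary.mem_iff]
          constructor <;> apply hg <;> rw [map_mul, map_star, map_one, hgw]
          · exact ((Unitary.mem_iff).1 (hw.1 l)).1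
          · exact ((Unitary.mem_iff).1 (hw.1 l)).2
        · apply hg
          rw [map_smul, map_mul, map_mul, hgw, hgw]
          exact hw.2 l k h }
  exact ⟨g.comp ((TorusRep.productEval j).comp (incl α)), hgw⟩

/-- A *-homomorphism on `𝔸_α^ℤ` is determined by its values on the generators. -/
theorem hom_ext {α : ℝ} {B : Type v} [CStarAlgebra B] {f g : NCTorus α →⋆ₐ[ℂ] B}
    (h : ∀ l, f (gen α l) = g (gen α l)) : f = g := by
  have hfg : Set.EqOn f g (StarAlgebra.adjoin ℂ (Set.range (gen α)) : Set (NCTorus α)) := by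
    intro a ha
    have hle : StarAlgebra.adjoin ℂ (Set.range (gen α)) ≤ StarAlgHom.equalizer f g :=
      StarAlgebra.adjoin_le (by rintro _ ⟨l, rfl⟩; exact h l)
    exact hle ha
  have hf : Continuous f := AddMonoidHomClass.continuous_of_bound f 1 fun a => by
    rw [one_mul]; exact NonUnitalStarAlgHom.norm_apply_le f a
  have hg : Continuous g := AddMonoidHomClass.continuous_of_bound g 1 fun a => by
    rw [one_mul]; exact NonUnitalStarAlgHom.norm_apply_le g a
  exact DFunLike.coe_injective (hf.ext_on (dense_adjoin_gen α) hg hfg)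

/-- The *-homomorphism `𝔸_α^ℤ → B` with `u_l ↦ w l`. -/
def lift {α : ℝ} {B : Type v} [CStarAlgebra B] {w : ℤ → B} (hw : IsTorusFamily α w) :
    NCTorus α →⋆ₐ[ℂ] B :=
  (exists_hom hw).choose

theorem lift_gen {α : ℝ} {B : Type v} [CStarAlgebra B] {w : ℤ → B} (hw : IsTorusFamily α w)
    (l : ℤ) : lift hw (gen α l) = w l :=
  (exists_hom hw).choose_spec l

theorem isTorusFamily_shift (α : ℝ) {h : ℤ → ℤ} (hh : StrictMono h) :
    IsTorusFamily α fun l => gen α (h l) :=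
  ⟨fun l => (isTorusFamily_gen α).1 (h l), fun _ _ hlk => (isTorusFamily_gen α).2 _ _ (hh hlk)⟩

/-- The *-endomorphism `α_h` with `α_h(u_l) = u_{h(l)}`, for `h : ℤ → ℤ` strictly increasing. -/
def endo (α : ℝ) {h : ℤ → ℤ} (hh : StrictMono h) : NCTorus α →⋆ₐ[ℂ] NCTorus α :=
  lift (isTorusFamily_shift α hh)

theorem endo_gen (α : ℝ) {h : ℤ → ℤ} (hh : StrictMono h) (l : ℤ) :
    endo α hh (gen α l) = gen α (h l) :=
  lift_gen _ l

theorem isTorusFamily_gauge (α : ℝ) (z : Circle) :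
    IsTorusFamily α fun l => (z : ℂ) • gen α l := by
  have hz : star (z : ℂ) * z = 1 := by
    rw [Complex.star_def, Complex.conj_mul', Circle.norm_coe]; norm_num
  refine ⟨fun l => ?_, fun l k hlk => ?_⟩
  · have hu := (Unitary.mem_iff).1 ((isTorusFamily_gen α).1 l)
    rw [Unitary.mem_iff]
    constructor
    · rw [star_smul, smul_mul_smul_comm, hu.1, hz, one_smul]
    · rw [star_smul, smul_mul_smul_comm, hu.2, mul_comm, hz, one_smul]
  · rw [smul_mul_smul_comm, smul_mul_smul_comm, (isTorusFamily_gen α).2 l k hlk, smul_comm]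

/-- The *-homomorphism underlying the gauge automorphism `γ_z`. -/
def gaugeHom (α : ℝ) (z : Circle) : NCTorus α →⋆ₐ[ℂ] NCTorus α :=
  lift (isTorusFamily_gauge α z)

theorem gaugeHom_gen (α : ℝ) (z : Circle) (l : ℤ) :
    gaugeHom α z (gen α l) = (z : ℂ) • gen α l :=
  lift_gen _ l

theorem gaugeHom_comp (α : ℝ) (z z' : Circle) (h : z * z' = 1) :
    (gaugeHom α z).comp (gaugeHom α z') = StarAlgHom.id ℂ (NCTorus α) := by
  have h' : (z' : ℂ) * z = 1 := by rw [mul_comm, ← Circle.coe_mul, h, Circle.coe_one]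
  apply hom_ext
  intro l
  rw [StarAlgHom.comp_apply, gaugeHom_gen, map_smul, gaugeHom_gen, smul_smul, h', one_smul]
  rfl

/-- The gauge automorphism `γ_z`, `z ∈ 𝕋`, with `γ_z(u_l) = z u_l` for all `l`. -/
def gauge (α : ℝ) (z : Circle) : NCTorus α ≃⋆ₐ[ℂ] NCTorus α :=
  StarAlgEquiv.ofStarAlgHom (gaugeHom α z) (gaugeHom α z⁻¹)
    (gaugeHom_comp α z⁻¹ z (inv_mul_cancel z)) (gaugeHom_comp α z z⁻¹ (mul_inv_cancel z))

theorem gauge_gen (α : ℝ) (z : Circle) (l : ℤ) : gauge α z (gen α l) = (z : ℂ) • gen α l :=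
  gaugeHom_gen α z l

/-- A state: a positive linear functional with value `1` at the unit. -/
def IsState {α : ℝ} (φ : NCTorus α →ₚ[ℂ] ℂ) : Prop := φ 1 = 1

/-- Spreadability: `φ ∘ α_h = φ` for every strictly increasing `h : ℤ → ℤ`. -/
def IsSpreadable {α : ℝ} (φ : NCTorus α →ₚ[ℂ] ℂ) : Prop :=
  ∀ (h : ℤ → ℤ) (hh : StrictMono h) (a : NCTorus α), φ (endo α hh a) = φ a

/-- Invariance under the gauge action of a subgroup `K` of the circle group. -/
def IsGaugeInvariantUnder {α : ℝ} (K : Subgroup Circle) (φ : NCTorus α →ₚ[ℂ] ℂ) : Prop :=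
  ∀ z ∈ K, ∀ a : NCTorus α, φ (gauge α z a) = φ a

end NCTorus

/-- The bicharacter `u_α(k, l) = exp(iαkl)` on `ℤ`. -/
def torusBichar (α : ℝ) (k l : ℤ) : ℂ := Complex.exp (α * k * l * Complex.I)

/-- `Δ_α = {k ∈ ℤ : u_α(k, k) = 1}`. -/
def torusDelta (α : ℝ) : Set ℤ := {k | torusBichar α k k = 1}

/-- `Δ_α^⊥ = {z ∈ 𝕋 : z^l = 1 for all l ∈ Δ_α}`. -/
def torusDeltaPerp (α : ℝ) : Subgroup Circle where
  carrier := {z | ∀ l ∈ torusDelta α, z ^ l = 1}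
  one_mem' l _ := one_zpow l
  mul_mem' hz hw l hl := by rw [mul_zpow, hz l hl, hw l hl, one_mul]
  inv_mem' hz l hl := by rw [inv_zpow, hz l hl, inv_one]

end

/-!
A monomial in the generators `u_l` and their adjoints is multiplied by `z ^ n` under the gauge
automorphism `γ_z`, where `n` is its degree. Monomials span a dense subspace, so it is enough to
show that a spreadable state `φ` vanishes on every monomial `a` of degree `n ∉ Δ_α`
(`NCTorus.IsMonomial.apply_eq_zero`).

Let `w_k`, `k ∈ ℕ`, be translates of `a` with consecutive disjoint supports. Then
`w_j w_k = q w_k w_j` for `j < k`, with `q = exp(iαn²) ≠ 1`. Spreadability makes `φ(w_k) = φ(a)`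
independent of `k`, and `c = φ(w_j* w_k)` and `d = φ(w_j w_k*)` independent of `j < k`. In the
semi-inner product defined by `φ`, the unitaries `w_k` are unit vectors whose pairwise inner products
are `c`. Applying Cauchy–Schwarz to averages over long blocks gives `|c| ≤ Re c` and
`|φ(a)|² ≤ Re c` (`norm_le_re_of_inner_eq`, `norm_sq_le_re_of_inner_eq`), so `c ≥ 0`, and
likewise `d ≥ 0` from the unitaries `w_k*`. The commutation relation gives `c̄ = q d`. As `|q| = 1`
and `q ≠ 1`, this forces `c = 0`, hence `φ(a) = 0`.
-/

/-! ### Sequences with constant inner products -/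

section ConstantGram

open scoped InnerProductSpace

variable {E : Type*} [SeminormedAddCommGroup E] [InnerProductSpace ℂ E]

theorem norm_sq_sum_of_re_inner_eq {ι : Type*} {v : ι → E} {r : ℝ} (hv : ∀ k, ‖v k‖ = 1)
    (hr : Pairwise fun j k => (⟪v j, v k⟫_ℂ).re = r) (s : Finset ι) :
    ‖∑ k ∈ s, v k‖ ^ 2 = s.card + s.card * (s.card - 1) * r := by
  classical
  induction s using Finset.induction_on with
  | empty => simp
  | insert a s ha ih =>
    have hs : (⟪v a, ∑ k ∈ s, v k⟫_ℂ).re = s.card * r := by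
      rw [inner_sum, Complex.re_sum, Finset.sum_congr rfl fun k hk =>
        hr (ne_of_mem_of_not_mem hk ha).symm, Finset.sum_const, nsmul_eq_mul]
    rw [Finset.sum_insert ha, @norm_add_sq ℂ, ih, hv, Finset.card_insert_of_notMem ha]
    simp only [RCLike.re_to_complex, hs]
    push_cast
    ring

theorem re_inner_pairwise_of_lt {v : ℕ → E} {c : ℂ} (hc : ∀ j k, j < k → ⟪v j, v k⟫_ℂ = c) :
    Pairwise fun j k => (⟪v j, v k⟫_ℂ).re = c.re := by
  intro j k hjk
  rcases hjk.lt_or_gt with h | h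
  · exact congrArg Complex.re (hc j k h)
  · rw [← hc k j h]
    exact inner_re_symm (𝕜 := ℂ) _ _

theorem le_of_forall_natCast_mul_sub_le {a r : ℝ}
    (h : ∀ N : ℕ, N * (N * a) ≤ N + N * (N - 1) * r) : a ≤ r := by
  by_contra! har
  obtain ⟨N, hN⟩ := exists_nat_gt ((1 - r) / (a - r))
  rw [div_lt_iff₀ (sub_pos.2 har)] at hN
  have h1 := h (N + 1)
  push_cast at h1
  have h2 : ((N : ℝ) + 1) * (a - r) ≤ 1 - r :=
    le_of_mul_le_mul_left (by linarith) (by positivity : (0 : ℝ) < N + 1)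
  linarith

/-- Cauchy–Schwarz for the sums over two consecutive blocks of length `N`, as `N → ∞`. -/
theorem norm_le_re_of_inner_eq {v : ℕ → E} {c : ℂ} (hv : ∀ k, ‖v k‖ = 1)
    (hc : ∀ j k, j < k → ⟪v j, v k⟫_ℂ = c) : ‖c‖ ≤ c.re := by
  refine le_of_forall_natCast_mul_sub_le fun N => ?_
  have hsq := norm_sq_sum_of_re_inner_eq hv (re_inner_pairwise_of_lt hc)
  set X := ∑ k ∈ Finset.range N, v k with hX
  set Y := ∑ k ∈ Finset.Ico N (N + N), v k with hY
  have hXn : ‖X‖ ^ 2 = N + N * (N - 1) * c.re := by rw [hX, hsq, Finset.card_range]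
  have hYn : ‖Y‖ ^ 2 = N + N * (N - 1) * c.re := by
    rw [hY, hsq, Nat.card_Ico, Nat.add_sub_cancel]
  have hXY : ⟪X, Y⟫_ℂ = N * (N * c) := by
    rw [hX, sum_inner, Finset.sum_congr rfl fun j hj => ?_, Finset.sum_const, Finset.card_range,
      nsmul_eq_mul]
    rw [hY, inner_sum, Finset.sum_congr rfl fun k hk => hc j k
      ((Finset.mem_range.1 hj).trans_le (Finset.mem_Ico.1 hk).1), Finset.sum_const,
      Nat.card_Ico, Nat.add_sub_cancel, nsmul_eq_mul]
  have h := norm_inner_le_norm (𝕜 := ℂ) X Y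
  rw [hXY, norm_mul, norm_mul, Complex.norm_natCast,
    (sq_eq_sq₀ (norm_nonneg _) (norm_nonneg _)).1 (hYn.trans hXn.symm), ← sq, hXn] at h
  exact h

/-- Cauchy–Schwarz for `x` and the sum over a block of length `N`, as `N → ∞`. -/
theorem norm_sq_le_re_of_inner_eq {v : ℕ → E} {c m : ℂ} {x : E} (hx : ‖x‖ = 1)
    (hv : ∀ k, ‖v k‖ = 1) (hc : ∀ j k, j < k → ⟪v j, v k⟫_ℂ = c) (hm : ∀ k, ⟪x, v k⟫_ℂ = m) :
    ‖m‖ ^ 2 ≤ c.re := by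
  refine le_of_forall_natCast_mul_sub_le fun N => ?_
  have hsq := norm_sq_sum_of_re_inner_eq hv (re_inner_pairwise_of_lt hc) (Finset.range N)
  rw [Finset.card_range] at hsq
  have h := norm_inner_le_norm (𝕜 := ℂ) x (∑ k ∈ Finset.range N, v k)
  rw [inner_sum, Finset.sum_congr rfl fun k _ => hm k, Finset.sum_const, Finset.card_range,
    nsmul_eq_mul, norm_mul, Complex.norm_natCast, hx, one_mul] at h
  rw [← hsq]
  calc (N : ℝ) * (N * ‖m‖ ^ 2) = (N * ‖m‖) ^ 2 := by ring
    _ ≤ _ := pow_le_pow_left₀ (by positivity) h 2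

end ConstantGram

/-! ### States and commuting up to a phase -/

section Phase

variable {A : Type*} [CStarAlgebra A]

theorem mul_star_of_mul_eq_smul_mul {c : ℂ} {x y : A} (hx : x ∈ unitary A)
    (h : x * y = c • (y * x)) : y * star x = c • (star x * y) := by
  calc y * star x = star x * (x * y) * star x := by
        rw [← mul_assoc, Unitary.star_mul_self_of_mem hx, one_mul]
    _ = c • (star x * y) := by
        rw [h, mul_smul_comm, smul_mul_assoc, mul_assoc, mul_assoc,
          Unitary.mul_star_self_of_mem hx, mul_one]

/-- The matrices `φ (star (w j) * w k)` and `φ (w j * star (w k))` are positive semidefinite with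
constant entries above the diagonal, so both constants are nonnegative and dominate
`‖φ (w k)‖ ^ 2`; the commutation relation makes them differ by the phase `q`. -/
theorem PositiveLinearMap.apply_eq_zero_of_mul_eq_smul_mul [PartialOrder A] [StarOrderedRing A]
    (φ : A →ₚ[ℂ] ℂ) (hφ : φ 1 = 1) {w : ℕ → A} (hw : ∀ k, w k ∈ unitary A) {m c d q : ℂ}
    (hm : ∀ k, φ (w k) = m) (hc : ∀ j k, j < k → φ (star (w j) * w k) = c)
    (hd : ∀ j k, j < k → φ (w j * star (w k)) = d)
    (hq : ∀ j k, j < k → w j * w k = q • (w k * w j)) (hq1 : ‖q‖ = 1) (hne : q ≠ 1) :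
    m = 0 := by
  have key : ∀ (v : ℕ → A), (∀ k, v k ∈ unitary A) → ∀ {e p : ℂ},
      (∀ j k, j < k → φ (star (v j) * v k) = e) → (∀ k, φ (v k) = p) →
      ‖e‖ ≤ e.re ∧ ‖p‖ ^ 2 ≤ e.re := by
    intro v hv e p he hp
    have hn : ∀ x ∈ unitary A, ‖φ.toPreGNS x‖ = 1 := fun x hx => by
      rw [φ.preGNS_norm_def, φ.ofPreGNS_toPreGNS, Unitary.star_mul_self_of_mem hx, hφ,
        Complex.one_re, Real.sqrt_one]
    refine ⟨norm_le_re_of_inner_eq (v := fun k => φ.toPreGNS (v k)) (fun k => hn _ (hv k)) he,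
      norm_sq_le_re_of_inner_eq (v := fun k => φ.toPreGNS (v k)) (hn _ (one_mem _))
        (fun k => hn _ (hv k)) he fun k => ?_⟩
    rw [φ.preGNS_inner_def, φ.ofPreGNS_toPreGNS, φ.ofPreGNS_toPreGNS, star_one, one_mul, hp]
  obtain ⟨hc1, hc2⟩ := key w hw hc hm
  obtain ⟨hd1, -⟩ := key (fun k => star (w k)) (fun k => Unitary.star_mem (hw k))
    (e := d) (p := star m) (fun j k hjk => by rw [star_star, hd j k hjk])
    (fun k => by rw [map_star, hm])
  have hc0 : (‖c‖ : ℂ) = c :=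
    (Complex.eq_coe_norm_of_nonneg
      (Complex.re_eq_norm.1 (hc1.antisymm' (Complex.re_le_norm c)))).symm
  have hd0 : (‖d‖ : ℂ) = d :=
    (Complex.eq_coe_norm_of_nonneg
      (Complex.re_eq_norm.1 (hd1.antisymm' (Complex.re_le_norm d)))).symm
  have hq0 : q ≠ 0 := norm_ne_zero_iff.1 (hq1.trans_ne one_ne_zero)
  -- The entry `star c` below the diagonal is `q * d`; as `c` and `d` are nonnegative, `q = 1`
  -- unless `c = 0`.
  have hstar : star (w 1) * w 0 = q • (w 0 * star (w 1)) := by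
    have h : w 1 * w 0 = q⁻¹ • (w 0 * w 1) := by rw [hq 0 1 one_pos, inv_smul_smul₀ hq0]
    rw [mul_star_of_mul_eq_smul_mul (hw 1) h, smul_inv_smul₀ hq0]
  have hcd : star c = q * d := by
    rw [← hc 0 1 one_pos, ← map_star, star_mul, star_star, hstar, map_smul, hd 0 1 one_pos,
      smul_eq_mul]
  have hcd' : ‖c‖ = ‖d‖ := by rw [← norm_star c, hcd, norm_mul, hq1, one_mul]
  have hc2' : c = q * c := by
    rw [← hc0, Complex.star_def, Complex.conj_ofReal, hc0, ← hd0, ← hcd', hc0] at hcd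
    exact hcd
  have hcz : c = 0 := by
    by_contra hcz
    exact hne (mul_right_cancel₀ hcz (hc2'.symm.trans (one_mul c).symm))
  rw [hcz, Complex.zero_re] at hc2
  exact norm_eq_zero.1 (pow_eq_zero_iff two_ne_zero |>.1 (hc2.antisymm (sq_nonneg _)))

end Phase

namespace NCTorus

/-! ### Monomials in the generators -/

/-- `IsMonomial α R n a`: the element `a` is a product of generators `u_l` and adjoints `u_l*`
with `|l| ≤ R`, and `n` is the number of generators minus the number of adjoints among the
factors. -/
inductive IsMonomial (α : ℝ) (R : ℤ) : ℤ → NCTorus α → Prop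
  | one : IsMonomial α R 0 1
  | gen_mul {n : ℤ} {a : NCTorus α} (l : ℤ) (hl : |l| ≤ R) (ha : IsMonomial α R n a) :
      IsMonomial α R (n + 1) (gen α l * a)
  | star_gen_mul {n : ℤ} {a : NCTorus α} (l : ℤ) (hl : |l| ≤ R) (ha : IsMonomial α R n a) :
      IsMonomial α R (n - 1) (star (gen α l) * a)

variable {α : ℝ} {R n : ℤ} {a : NCTorus α}

theorem IsMonomial.mono {S : ℤ} (hRS : R ≤ S) (ha : IsMonomial α R n a) : IsMonomial α S n a := by
  induction ha with
  | one => exact .one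
  | gen_mul l hl _ ih => exact .gen_mul l (hl.trans hRS) ih
  | star_gen_mul l hl _ ih => exact .star_gen_mul l (hl.trans hRS) ih

theorem IsMonomial.mem_unitary (ha : IsMonomial α R n a) : a ∈ unitary (NCTorus α) := by
  induction ha with
  | one => exact one_mem _
  | gen_mul l _ _ ih => exact mul_mem ((isTorusFamily_gen α).1 l) ih
  | star_gen_mul l _ _ ih => exact mul_mem (Unitary.star_mem ((isTorusFamily_gen α).1 l)) ih

theorem IsMonomial.gauge_apply (z : Circle) (ha : IsMonomial α R n a) :
    gauge α z a = (z : ℂ) ^ n • a := by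
  have hz : (z : ℂ) ≠ 0 := Circle.coe_ne_zero z
  induction ha with
  | one => rw [map_one, zpow_zero, one_smul]
  | gen_mul l _ _ ih =>
    rw [map_mul, gauge_gen, ih, smul_mul_smul_comm, zpow_add_one₀ hz, mul_comm]
  | star_gen_mul l _ _ ih =>
    rw [map_mul, map_star, gauge_gen, ih, star_smul, smul_mul_smul_comm, zpow_sub_one₀ hz, mul_comm,
      Complex.star_def, ← Circle.coe_inv_eq_conj, Circle.coe_inv]

/-- Applied to `α_h` and `α_k`: on a monomial, these only depend on the values of `h` and `k` at the
indices that occur. -/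
theorem IsMonomial.hom_congr (ha : IsMonomial α R n a) {B : Type*} [CStarAlgebra B]
    {f g : NCTorus α →⋆ₐ[ℂ] B} (hfg : ∀ l, |l| ≤ R → f (gen α l) = g (gen α l)) : f a = g a := by
  induction ha with
  | one => rw [map_one, map_one]
  | gen_mul l hl _ ih => rw [map_mul, map_mul, hfg l hl, ih]
  | star_gen_mul l hl _ ih => rw [map_mul, map_mul, map_star, map_star, hfg l hl, ih]

theorem IsMonomial.hom_mul_eq_smul_mul (ha : IsMonomial α R n a) {B : Type*} [CStarAlgebra B]
    {f : NCTorus α →⋆ₐ[ℂ] B} {y : B} {c : ℂ} (hc : c ≠ 0)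
    (h : ∀ l, |l| ≤ R → f (gen α l) * y = c • (y * f (gen α l))) :
    f a * y = c ^ n • (y * f a) := by
  induction ha with
  | one => rw [map_one, one_mul, mul_one, zpow_zero, one_smul]
  | gen_mul l hl _ ih =>
    rw [map_mul, mul_assoc, ih, mul_smul_comm, ← mul_assoc, h l hl, smul_mul_assoc, smul_smul,
      mul_assoc, zpow_add_one₀ hc]
  | star_gen_mul l hl _ ih =>
    have hu : f (gen α l) ∈ unitary B := Unitary.map_mem f ((isTorusFamily_gen α).1 l)
    rw [map_mul, map_star, mul_assoc, ih, mul_smul_comm, ← mul_assoc,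
      ← inv_smul_smul₀ hc (star (f (gen α l)) * y), ← mul_star_of_mul_eq_smul_mul hu (h l hl),
      smul_mul_assoc, smul_smul, mul_assoc, zpow_sub_one₀ hc]

/-- Monomials of degrees `n` and `m` such that all indices of the first are smaller than all
indices of the second commute up to the phase `exp(iα n m)`. -/
theorem IsMonomial.endo_mul_endo {S m : ℤ} {b : NCTorus α} (ha : IsMonomial α R n a)
    (hb : IsMonomial α S m b) {h k : ℤ → ℤ} (hh : StrictMono h) (hk : StrictMono k)
    (hlt : ∀ x y, |x| ≤ R → |y| ≤ S → h x < k y) :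
    endo α hh a * endo α hk b =
      (Complex.exp (α * Complex.I) ^ m) ^ n • (endo α hk b * endo α hh a) := by
  have hq := Complex.exp_ne_zero (α * Complex.I)
  refine ha.hom_mul_eq_smul_mul (zpow_ne_zero _ hq) fun x hx => ?_
  rw [hb.hom_mul_eq_smul_mul (inv_ne_zero hq) fun y hy => ?_, smul_smul, inv_zpow,
    mul_inv_cancel₀ (zpow_ne_zero _ hq), one_smul]
  rw [endo_gen, endo_gen, (isTorusFamily_gen α).2 _ _ (hlt x y hx hy), inv_smul_smul₀ hq]

theorem strictMono_add_const (s : ℤ) : StrictMono fun x : ℤ => x + s :=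
  fun _ _ h => by simpa using h

/-- The translates of a monomial of degree `n` by multiples of a number larger than the diameter of
its support commute up to the phase `exp(iα n²)`. Any two of them can be moved to any other two in
the same order by a strictly increasing map. -/
theorem IsMonomial.apply_eq_zero (ha : IsMonomial α R n a) {φ : NCTorus α →ₚ[ℂ] ℂ}
    (hφ : IsState φ) (hs : IsSpreadable φ) (hn : n ∉ torusDelta α) : φ a = 0 := by
  wlog hR : 0 ≤ R generalizing R
  · exact this (ha.mono (not_le.1 hR).le) le_rfl
  let w : ℕ → NCTorus α := fun k => endo α (strictMono_add_const (k * (2 * R + 1))) a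
  have hstep : ∀ {j k : ℕ}, j < k → ((j : ℤ) + 1) * (2 * R + 1) ≤ k * (2 * R + 1) := fun hjk =>
    mul_le_mul_of_nonneg_right (by exact_mod_cast hjk) (by linarith)
  -- The map is the translation by `j * (2 * R + 1)` on the support of `w 0`, and by
  -- `(k - 1) * (2 * R + 1)` on the support of `w 1`.
  have hpair : ∀ j k, j < k → ∃ (h : ℤ → ℤ) (hh : StrictMono h),
      endo α hh (w 0) = w j ∧ endo α hh (w 1) = w k := by
    intro j k hjk
    have hjk' := hstep hjk
    have hh : StrictMono fun x : ℤ =>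
        if x ≤ R then x + j * (2 * R + 1) else x + (k * (2 * R + 1) - (2 * R + 1)) := by
      intro x y hxy
      dsimp only
      split_ifs <;> linarith
    refine ⟨_, hh, ?_, ?_⟩
    · refine ha.hom_congr (f := (endo α hh).comp (endo α _)) fun l hl => ?_
      rw [abs_le] at hl
      rw [StarAlgHom.comp_apply, endo_gen, endo_gen, endo_gen]
      congr 1
      rw [Nat.cast_zero, zero_mul, add_zero, if_pos hl.2]
    · refine ha.hom_congr (f := (endo α hh).comp (endo α _)) fun l hl => ?_
      rw [abs_le] at hl
      rw [StarAlgHom.comp_apply, endo_gen, endo_gen, endo_gen]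
      congr 1
      rw [Nat.cast_one, one_mul, if_neg (by linarith)]
      ring
  have hqn : (Complex.exp (α * Complex.I) ^ n) ^ n = torusBichar α n n := by
    rw [← Complex.exp_int_mul, ← Complex.exp_int_mul, torusBichar]
    congr 1
    ring
  refine φ.apply_eq_zero_of_mul_eq_smul_mul hφ (w := w)
    (c := φ (star (w 0) * w 1)) (d := φ (w 0 * star (w 1))) (q := torusBichar α n n)
    (fun k => Unitary.map_mem _ ha.mem_unitary) (fun k => hs _ _ a) ?_ ?_ ?_ ?_ hn
  · intro j k hjk
    obtain ⟨h, hh, h0, h1⟩ := hpair j k hjk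
    rw [← h0, ← h1, ← map_star, ← map_mul, hs]
  · intro j k hjk
    obtain ⟨h, hh, h0, h1⟩ := hpair j k hjk
    rw [← h0, ← h1, ← map_star, ← map_mul, hs]
  · intro j k hjk
    rw [← hqn]
    refine ha.endo_mul_endo ha _ _ fun x y hx hy => ?_
    have hjk' := hstep hjk
    rw [abs_le] at hx hy
    linarith
  · rw [← hqn, norm_zpow, norm_zpow, Complex.norm_exp_ofReal_mul_I, one_zpow, one_zpow]

theorem exists_isMonomial_of_mem_closure
    (ha : a ∈ Submonoid.closure (Set.range (gen α) ∪ star (Set.range (gen α)))) :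
    ∃ R n, IsMonomial α R n a := by
  induction ha using Submonoid.closure_induction_left with
  | one => exact ⟨0, 0, .one⟩
  | mul_left x hx y _ ih =>
    obtain ⟨R, n, hy⟩ := ih
    rcases hx with ⟨l, rfl⟩ | ⟨l, hl⟩
    · exact ⟨_, _, .gen_mul l (le_max_right R |l|) (hy.mono (le_max_left R |l|))⟩
    · rw [← star_star x, ← hl]
      exact ⟨_, _, .star_gen_mul l (le_max_right R |l|) (hy.mono (le_max_left R |l|))⟩

/-! ### Gauge invariance -/

theorem ext_of_forall_isMonomial {f g : NCTorus α →L[ℂ] ℂ}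
    (h : ∀ R n a, IsMonomial α R n a → f a = g a) : f = g := by
  refine ContinuousLinearMap.ext_on
    (s := (Submonoid.closure (Set.range (gen α) ∪ star (Set.range (gen α))) : Set (NCTorus α)))
    ?_ fun a ha => ?_
  · have hspan : (StarAlgebra.adjoin ℂ (Set.range (gen α)) : Set (NCTorus α)) =
        (Submodule.span ℂ (Submonoid.closure (Set.range (gen α) ∪ star (Set.range (gen α))) :
          Set (NCTorus α)) : Submodule ℂ (NCTorus α)) := by
      rw [← Algebra.adjoin_eq_span, ← StarAlgebra.adjoin_toSubalgebra]
      rfl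
    rw [← hspan]
    exact dense_adjoin_gen α
  · obtain ⟨R, n, ha⟩ := exists_isMonomial_of_mem_closure ha
    exact h R n a ha

theorem IsSpreadable.isGaugeInvariantUnder {φ : NCTorus α →ₚ[ℂ] ℂ} (hφ : IsState φ)
    (hs : IsSpreadable φ) : IsGaugeInvariantUnder (torusDeltaPerp α) φ := by
  intro z hz a
  have hγ : Continuous (gauge α z) := (StarAlgEquiv.isometry (gauge α z)).continuous
  have hφc : Continuous φ := map_continuous φ
  let f : NCTorus α →L[ℂ] ℂ :=
    ⟨φ.toLinearMap ∘ₗ (gaugeHom α z).toAlgHom.toLinearMap, hφc.comp hγ⟩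
  let g : NCTorus α →L[ℂ] ℂ := ⟨φ.toLinearMap, hφc⟩
  have hfg : f = g := ext_of_forall_isMonomial fun R n a ha => by
    change φ (gauge α z a) = φ a
    rw [ha.gauge_apply, map_smul]
    by_cases hn : n ∈ torusDelta α
    · rw [← Circle.coe_zpow, hz n hn, Circle.coe_one, one_smul]
    · rw [ha.apply_eq_zero hφ hs hn, smul_zero]
  exact congrArg (fun F : NCTorus α →L[ℂ] ℂ => F a) hfg

end NCTorus

theorem torusDeltaPerp_eq_top {α : ℝ} (hα : Irrational (α / (2 * Real.pi))) :
    torusDeltaPerp α = ⊤ := by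
  refine eq_top_iff.2 fun z _ k hk => ?_
  have hk0 : k = 0 := by
    by_contra hk0
    obtain ⟨n, hn⟩ := Complex.exp_eq_one_iff.1 hk
    have h1 : α * k * k = n * (2 * Real.pi) := by
      have h2 : (α * k * k : ℂ) = n * (2 * Real.pi) :=
        mul_right_cancel₀ Complex.I_ne_zero (by rw [hn]; ring)
      exact_mod_cast h2
    refine hα ⟨(n : ℚ) / (k * k), ?_⟩
    have hkr : (k : ℝ) ≠ 0 := Int.cast_ne_zero.2 hk0
    have := Real.pi_ne_zero
    push_cast
    field_simp
    linarith
  rw [hk0, zpow_zero]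

theorem mainTheorem4 (α : ℝ) :
    (∀ φ : NCTorus α →ₚ[ℂ] ℂ, NCTorus.IsState φ → NCTorus.IsSpreadable φ →
      NCTorus.IsGaugeInvariantUnder (torusDeltaPerp α) φ) ∧
    (Irrational (α / (2 * Real.pi)) →
      ∀ φ : NCTorus α →ₚ[ℂ] ℂ, NCTorus.IsState φ → NCTorus.IsSpreadable φ →
        NCTorus.IsGaugeInvariantUnder ⊤ φ) :=
  ⟨fun _ hφ hs => hs.isGaugeInvariantUnder hφ, fun hα _ hφ hs =>
    torusDeltaPerp_eq_top hα ▸ hs.isGaugeInvariantUnder hφ⟩
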